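/- All rings are commutative. For a module $M$ over a ring $R$, the Rees algebra of $M$ is $\mathcal R(M)=\operatorname{Sym}(M)/\bigcap_g \ker(\operatorname{Sym}(g))$, where $g$ ranges over all $R$-linear maps from $M$ to free $R$-modules. If $M$ is finitely generated and $U\subset L\subset M$ are submodules, $L$ is said to be integral over $U$ in $M$ if the ring extension $R[U']\subset R[L']$ is integral, where $U',L'$ are the images of $U,L$ in $\mathcal R(M)$ and $R[U'],R[L']$ are the $R$-subalgebras of $\mathcal R(M)$ that they generate. A linear map $f:M\to F$ to a free $R$-module $F$ is versal if every linear map from $M$ to a free $R$-module factors through $f$. Theorem 2.2. Let $R$ be a Noetherian ring, let $M$ be a finitely generated $R$-module, let $U\subset L\subset M$ be submodules, and let $f:M\to F$ be a versal map from $M$ to a free $R$-module $F$. The following are equivalent: 1. $L$ is integral over $U$ in $M$. 2. For every minimal prime $Q$ of $R$, the module $L'$ is integral over $U'$ in $M'$, where $'$ denotes images in $F/QF$ (under the map induced by $f$), all regarded as modules over $R/Q$. 3. For every linear map $M\to G$ to a free $R$-module $G$ and every homomorphism $R\to S$ to a domain $S$, the module $L'$ is integral over $U'$ in $M'$, where $'$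 denotes tensoring with $S$ and taking images in $S\otimes_R G$, regarded as modules over $S$. 4. For every homomorphism $R\to V$ to a rank one discrete valuation ring $V$ whose kernel is a minimal prime of $R$, we have $U'=L'$, where $'$ denotes tensoring with $V$ and taking images in $V\otimes_R F$ (under the map induced by $f$). 5. (Valuative criterion of integrality) For every linear map $M\to G$ to a free $R$-module $G$ and every homomorphism $R\to V$ to a rank one discrete valuation ring $V$, we have $U'=L'$, where $'$ denotes tensoring with $V$ and taking images in $V\otimes_R G$. -/

import Mathlib

open scoped TensorProduct

universe u v w s g

/-- The algebra homomorphism `Sym(φ) : Sym(M) → Sym(N)` induced by a linear map `φ : M → N`. -/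
noncomputable def symMap {R : Type u} [CommRing R] {M : Type v} [AddCommGroup M] [Module R M]
    {N : Type w} [AddCommGroup N] [Module R N] (φ : M →ₗ[R] N) :
    SymmetricAlgebra R M →ₐ[R] SymmetricAlgebra R N :=
  SymmetricAlgebra.lift (SymmetricAlgebra.ι R N ∘ₗ φ)

/-- The ideal `⋂ ker Sym(φ)` of `Sym(M)`, the intersection being over all linear maps `φ` from `M`
to free `R`-modules. (The image of `M` always lies in the span of at most `max |M| ℵ₀` members of a
basis, so that free modules in the universe of `R` and `M` account for all free modules.) -/
noncomputable def moduleReesIdeal (R : Type u) [CommRing R] (M : Type v) [AddCommGroup M]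
    [Module R M] : Ideal (SymmetricAlgebra R M) :=
  ⨅ (G : Type (max u v)) (_ : AddCommGroup G) (_ : Module R G) (_ : Module.Free R G)
    (φ : M →ₗ[R] G), RingHom.ker (symMap φ)

/-- The Rees algebra of a module: `Sym(M)` modulo the intersection of the kernels of `Sym(φ)` over
all linear maps `φ` from `M` to free modules. -/
abbrev ModuleReesAlgebra (R : Type u) [CommRing R] (M : Type v) [AddCommGroup M]
    [Module R M] : Type (max u v) :=
  SymmetricAlgebra R M ⧸ moduleReesIdeal R M

/-- The canonical linear map from a module to (the degree one part of) its Rees algebra. -/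
noncomputable def toModuleRees (R : Type u) [CommRing R] (M : Type v) [AddCommGroup M]
    [Module R M] : M →ₗ[R] ModuleReesAlgebra R M :=
  (Ideal.Quotient.mkₐ R (moduleReesIdeal R M)).toLinearMap ∘ₗ SymmetricAlgebra.ι R M

/-- The subalgebra `R[U']` of the Rees algebra of `M` generated by the image `U'` of a
submodule `U` of `M`. -/
noncomputable def reesAdjoin {R : Type u} [CommRing R] {M : Type v} [AddCommGroup M] [Module R M]
    (U : Submodule R M) : Subalgebra R (ModuleReesAlgebra R M) :=
  Algebra.adjoin R (U.map (toModuleRees R M) : Set (ModuleReesAlgebra R M))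

/-- For submodules `U ⊆ L` of `M`: `L` is integral over `U` in `M`, that is, every element of
`R[L']` is integral over `R[U']`, where `U'` and `L'` are the images in the Rees algebra of `M`. -/
def IsIntegralIn {R : Type u} [CommRing R] {M : Type v} [AddCommGroup M] [Module R M]
    (U L : Submodule R M) : Prop :=
  ∀ x ∈ reesAdjoin L, IsIntegral (reesAdjoin U) x

/-- For submodules `U' ⊆ L' ⊆ M'` of a module `P`: `L'` is integral over `U'` in the module `M'`. -/
def IsIntegralWithin {R : Type u} [CommRing R] {P : Type v} [AddCommGroup P] [Module R P]
    (U' L' M' : Submodule R P) : Prop :=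
  IsIntegralIn (M := M') (U'.submoduleOf M') (L'.submoduleOf M')

/-- A linear map `f` from `M` to a free module `F` is versal if every linear map from `M` to a free
module factors through `f`. -/
def IsVersal {R : Type u} [CommRing R] {M : Type v} [AddCommGroup M] [Module R M]
    {F : Type w} [AddCommGroup F] [Module R F] (f : M →ₗ[R] F) : Prop :=
  Module.Free R F ∧
    ∀ (G : Type (max u v)) [AddCommGroup G] [Module R G] [Module.Free R G] (φ : M →ₗ[R] G),
      ∃ h : F →ₗ[R] G, φ = h ∘ₗ f

/-- The image of `U ⊆ M` in `F / QF` under the map induced by `f : M → F`, as an `R / Q`-submodule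
of `F / QF`. -/
def imageMod {R : Type u} [CommRing R] {M : Type v} [AddCommGroup M] [Module R M]
    {F : Type w} [AddCommGroup F] [Module R F] (Q : Ideal R) (f : M →ₗ[R] F)
    (U : Submodule R M) : Submodule (R ⧸ Q) (F ⧸ (Q • ⊤ : Submodule R F)) where
  carrier := (fun x => (Q • ⊤ : Submodule R F).mkQ (f x)) '' (U : Set M)
  add_mem' := by
    rintro _ _ ⟨x, hx, rfl⟩ ⟨y, hy, rfl⟩
    exact ⟨x + y, U.add_mem hx hy, by simp⟩
  zero_mem' := ⟨0, U.zero_mem, by simp⟩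
  smul_mem' := by
    intro c
    obtain ⟨r, rfl⟩ := Ideal.Quotient.mk_surjective c
    rintro _ ⟨x, hx, rfl⟩
    exact ⟨r • x, U.smul_mem r hx, by simp⟩

/-- The image of `S ⊗ U` in `S ⊗ G` under the map induced by `U ⊆ M` and `φ : M → G`, as an
`S`-submodule. -/
noncomputable def imageTensor {R : Type u} [CommRing R] {M : Type v} [AddCommGroup M] [Module R M]
    {G : Type w} [AddCommGroup G] [Module R G] (S : Type s) [CommRing S] [Algebra R S]
    (φ : M →ₗ[R] G) (U : Submodule R M) : Submodule S (S ⊗[R] G) :=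
  LinearMap.range ((φ ∘ₗ U.subtype).baseChange S)

/-!
All integrality statements are moved into symmetric algebras of free modules, that is, polynomial
rings, and tested on linear forms (`IsIntegralVia`). If `f : M → F` is versal, the Rees algebra of
`M` is a subring of `Sym(F)` (`IsVersal.ker_symMap`); over a domain every embedding of a finitely
generated module into a free module has the same effect (`ker_symMap_of_injective`), because maps
to free modules extend after passage to the field of fractions. So integrality of `L` over `U`, in
`M` or in an image of `M`, means that the linear forms coming from `L` are integral over the algebra
generated by those coming from `U` (`isIntegralIn_iff_isIntegralVia`,
`isIntegralWithin_iff_isIntegralVia`). In this form it is preserved by base change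
(`IsIntegralVia.baseChange`).

Over a discrete valuation ring `V`, a linear form integral over `V[U']` lies in `U'`: otherwise, by
the Smith normal form, a functional with values in the field of fractions maps `U'` into `V` but not
the given form, against the integral closedness of `V` (`mem_of_isIntegral_adjoin_image`).

Conversely, let `U'` and `L'` agree over all discrete valuation rings with kernel the minimal
prime `Q`. If a linear form `x` from `L` is not integral over the Noetherian domain `(R / Q)[U']`,
some discrete valuation ring contains this domain but not `x`
(`exists_isDiscreteValuationRing_of_not_isIntegral`), which is absurd since `x` lies in `V U'`. To
find it, one takes a minimal prime over the nonunit `x⁻¹` of `(R / Q)[U'][x⁻¹]`, which has height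
one by Krull's principal ideal theorem, and a valuation ring dominating the localization there,
which is Noetherian by the Krull–Akizuki theorem (`isNoetherianRing_of_krullDimLE_one`).

Finally, integrality modulo each of the finitely many minimal primes of `R` gives integrality, since
the product of the integral equations is nilpotent (`isIntegralVia_of_forall_minimalPrimes`).
-/

/-! ### Overrings of one-dimensional Noetherian local domains -/

section KrullAkizuki

theorem isArtinianRing_quotient_span_singleton {A : Type*} [CommRing A] [IsDomain A]
    [IsNoetherianRing A] [Ring.KrullDimLE 1 A] {c : A} (hc : c ≠ 0) :
    IsArtinianRing (A ⧸ Ideal.span {c}) := by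
  rw [isArtinianRing_iff_krullDimLE_zero, Ring.KrullDimLE, Order.krullDimLE_iff,
    ← ENat.WithBot.add_le_add_one_right_iff, Nat.cast_zero, zero_add]
  exact (ringKrullDim_quotient_succ_le_of_nonZeroDivisor (mem_nonZeroDivisors_of_ne_zero hc)).trans
    (Order.KrullDimLE.krullDim_le)

variable {A W : Type*} [CommRing A] [IsDomain A] [IsLocalRing A] [IsNoetherianRing A]
  [Ring.KrullDimLE 1 A] [CommRing W] [IsDomain W] [Algebra A W]

/-- Inverting a nonzero element of the maximal ideal of a one-dimensional Noetherian local domain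
inverts every nonzero element. -/
theorem exists_pow_eq_mul_of_mem_maximalIdeal {a c : A}
    (ha : a ∈ IsLocalRing.maximalIdeal A) (hc : c ≠ 0) : ∃ (n : ℕ) (d : A), a ^ n = c * d := by
  have := isArtinianRing_quotient_span_singleton hc
  obtain ⟨n, y, hy⟩ := IsArtinian.exists_pow_succ_smul_dvd
    (Ideal.Quotient.mk (Ideal.span {c}) a) (1 : A ⧸ Ideal.span {c})
  obtain ⟨y, rfl⟩ := Ideal.Quotient.mk_surjective y
  have h : a ^ n - a ^ (n + 1) * y ∈ Ideal.span {c} := by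
    rw [← Ideal.Quotient.eq_zero_iff_mem]
    simp only [smul_eq_mul, mul_one, Nat.succ_eq_add_one] at hy
    simp [hy]
  obtain ⟨d, hd⟩ := Ideal.mem_span_singleton'.mp h
  have hu : IsUnit (1 - a * y) :=
    IsLocalRing.isUnit_one_sub_self_of_mem_nonunits _
      ((IsLocalRing.mem_maximalIdeal _).mp (Ideal.mul_mem_right _ _ ha))
  obtain ⟨u, hu⟩ := hu
  refine ⟨n, d * ↑u⁻¹, ?_⟩
  have : a ^ n * u = c * d := by rw [hu, mul_comm c, hd]; ring
  rw [← mul_assoc, ← this, mul_assoc, Units.mul_inv, mul_one]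

/-- The key step of the Krull–Akizuki theorem: if `W` consists of fractions of `A` and `a` is a
nonzero element of the maximal ideal, then `W ⊆ a⁻ᵐ A + a W` for some `m`. The exponent is one at
which the images in the Artinian ring `A / a` of the ideals `aⁿ W ∩ A` become stationary. -/
theorem exists_forall_pow_mul_eq_add (hinj : Function.Injective (algebraMap A W))
    (hfrac : ∀ w : W, ∃ q : A, q ≠ 0 ∧ ∃ p : A, algebraMap A W q * w = algebraMap A W p)
    {a : A} (ha : a ∈ IsLocalRing.maximalIdeal A) (ha0 : a ≠ 0) :
    ∃ m : ℕ, ∀ x : W, ∃ (w : W) (r : A),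
      algebraMap A W a ^ m * (x - algebraMap A W a * w) = algebraMap A W r := by
  have := isArtinianRing_quotient_span_singleton ha0
  have hα0 : algebraMap A W a ≠ 0 := (map_ne_zero_iff _ hinj).mpr ha0
  set α := algebraMap A W a with hα
  let J : ℕ →o (Ideal (A ⧸ Ideal.span {a}))ᵒᵈ :=
    { toFun n := OrderDual.toDual
        (((Ideal.span {α ^ n}).comap (algebraMap A W)).map (Ideal.Quotient.mk (Ideal.span {a})))
      monotone' i j hij := by
        refine OrderDual.toDual_le_toDual.mpr (Ideal.map_mono (Ideal.comap_mono ?_))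
        rw [Ideal.span_singleton_le_span_singleton]
        exact pow_dvd_pow _ hij }
  obtain ⟨m, hm⟩ := IsArtinian.monotone_stabilizes J
  have hstab (n : ℕ) (hn : m ≤ n) (r : A) (w : W) (hr : algebraMap A W r = α ^ n * w) :
      ∃ (w' : W) (r' : A), algebraMap A W r = α ^ (n + 1) * w' + α * algebraMap A W r' := by
    have h1 : Ideal.Quotient.mk (Ideal.span {a}) r ∈ OrderDual.ofDual (J n) :=
      Ideal.mem_map_of_mem _ (by
        rw [Ideal.mem_comap, hr]
        exact Ideal.mem_span_singleton.mpr (dvd_mul_right _ _))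
    rw [← hm n hn, hm (n + 1) (by omega)] at h1
    obtain ⟨r₁, hr₁, h2⟩ :=
      (Ideal.mem_map_iff_of_surjective _ Ideal.Quotient.mk_surjective).mp h1
    obtain ⟨w', hw'⟩ := Ideal.mem_span_singleton.mp (Ideal.mem_comap.mp hr₁)
    obtain ⟨r', hr'⟩ := Ideal.mem_span_singleton'.mp ((Ideal.Quotient.mk_eq_mk_iff_sub_mem _ _).mp
      h2.symm)
    refine ⟨w', r', ?_⟩
    rw [← hw', hα, ← map_mul, ← map_add]
    congr 1
    linear_combination -hr'
  refine ⟨m, fun x ↦ ?_⟩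
  have hdesc (k : ℕ) : (∃ (w : W) (r : A), α ^ (m + k) * (x - α * w) = algebraMap A W r) →
      ∃ (w : W) (r : A), α ^ m * (x - α * w) = algebraMap A W r := by
    induction k with
    | zero => exact id
    | succ k ih =>
      rintro ⟨w, r, h⟩
      obtain ⟨w', r', h'⟩ := hstab (m + (k + 1)) (by omega) r _ h.symm
      refine ih ⟨w + w', r', mul_left_cancel₀ hα0 ?_⟩
      rw [h'] at h
      linear_combination h
  obtain ⟨q, hq, p, hp⟩ := hfrac x
  obtain ⟨n, d, hd⟩ := exists_pow_eq_mul_of_mem_maximalIdeal ha hq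
  refine hdesc n ⟨0, a ^ m * (d * p), ?_⟩
  rw [mul_zero, sub_zero, map_mul, map_mul, ← hp, pow_add, hα, ← map_pow, ← map_pow, hd]
  simp only [map_mul]
  ring

/-- The Krull–Akizuki theorem for local domains: a ring of fractions of elements of a
one-dimensional Noetherian local domain is Noetherian. -/
theorem isNoetherianRing_of_krullDimLE_one (hinj : Function.Injective (algebraMap A W))
    (hfrac : ∀ w : W, ∃ q : A, q ≠ 0 ∧ ∃ p : A, algebraMap A W q * w = algebraMap A W p) :
    IsNoetherianRing W := by
  rw [isNoetherianRing_iff_ideal_fg]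
  intro I
  by_cases hI : I = ⊥
  · rw [hI]; exact Submodule.fg_bot
  obtain ⟨x, hxI, hx0⟩ := Submodule.exists_mem_ne_zero_of_ne_bot hI
  obtain ⟨q, hq, a, hqa⟩ := hfrac x
  have haI : algebraMap A W a ∈ I := hqa ▸ I.mul_mem_left _ hxI
  have hq0 : algebraMap A W q ≠ 0 := (map_ne_zero_iff _ hinj).mpr hq
  have ha0 : a ≠ 0 := by
    rintro rfl
    rw [map_zero] at hqa
    exact (mul_ne_zero hq0 hx0) hqa
  by_cases ha : IsUnit a
  · rw [I.eq_top_of_isUnit_mem haI (ha.map _)]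
    exact ⟨{1}, by simp⟩
  obtain ⟨m, hm⟩ := exists_forall_pow_mul_eq_add hinj hfrac
    ((IsLocalRing.mem_maximalIdeal a).mpr ha) ha0
  set α := algebraMap A W a with hα
  have hα0 : α ≠ 0 := (map_ne_zero_iff _ hinj).mpr ha0
  -- `N = aᵐ I ∩ A`; generators of `N`, divided by `aᵐ`, generate `I` together with `a`.
  let N : Ideal A := ((I.restrictScalars A).map (LinearMap.mulLeft A (α ^ m))).comap
    (Algebra.linearMap A W)
  obtain ⟨t, ht⟩ := (isNoetherianRing_iff_ideal_fg A).mp inferInstance N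
  have hN (r : A) : r ∈ N ↔ ∃ j ∈ I, α ^ m * j = algebraMap A W r := by
    simp [N, Submodule.mem_map]
  have htN (r : A) (hr : r ∈ t) : ∃ j ∈ I, α ^ m * j = algebraMap A W r :=
    (hN r).mp (ht ▸ Ideal.subset_span hr)
  choose! g hgI hg using htN
  classical
  refine ⟨insert α (t.image g), le_antisymm (Ideal.span_le.mpr ?_) fun y hy ↦ ?_⟩
  · intro y hy
    rw [Finset.mem_coe, Finset.mem_insert, Finset.mem_image] at hy
    obtain rfl | ⟨r, hr, rfl⟩ := hy
    · exact haI
    · exact hgI r hr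
  · set I' : Ideal W := Ideal.span (insert α (t.image g) : Finset W)
    have hαI' : α ∈ I' := Ideal.subset_span (by simp)
    have hlift (r : A) (hr : r ∈ N) : ∃ j ∈ I', α ^ m * j = algebraMap A W r := by
      rw [← ht] at hr
      induction hr using Submodule.span_induction with
      | mem r hr =>
        exact ⟨g r, Ideal.subset_span (by
          simp only [Finset.coe_insert, Finset.coe_image]
          exact Or.inr ⟨r, hr, rfl⟩), hg r hr⟩
      | zero => exact ⟨0, zero_mem _, by simp⟩
      | add r₁ r₂ _ _ h₁ h₂ =>
        obtain ⟨j₁, hj₁, e₁⟩ := h₁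
        obtain ⟨j₂, hj₂, e₂⟩ := h₂
        exact ⟨j₁ + j₂, add_mem hj₁ hj₂, by rw [mul_add, e₁, e₂, map_add]⟩
      | smul c r _ h =>
        obtain ⟨j, hj, e⟩ := h
        exact ⟨algebraMap A W c * j, I'.mul_mem_left _ hj, by
          rw [smul_eq_mul, map_mul, ← e]; ring⟩
    obtain ⟨w, r, hr⟩ := hm y
    obtain ⟨j, hj, e⟩ := hlift r ((hN r).mpr ⟨_, sub_mem hy (I.mul_mem_right w haI), hr⟩)
    have : y - α * w = j := mul_left_cancel₀ (pow_ne_zero m hα0) (hr.trans e.symm)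
    rw [sub_eq_iff_eq_add.mp this]
    exact add_mem hj (I'.mul_mem_right _ hαI')

end KrullAkizuki

/-! ### Discrete valuation rings above a Noetherian domain -/

/-- A nonzero nonunit of a Noetherian domain is a nonunit of some discrete valuation ring between
the domain and its field of fractions. The domain is localized at a minimal prime over the
element, which has height one by Krull's principal ideal theorem; a valuation ring dominating the
localization is Noetherian by the Krull–Akizuki theorem. -/
theorem exists_valuationSubring_isDiscreteValuationRing {A : Type*} [CommRing A] [IsDomain A]
    [IsNoetherianRing A] {K : Type*} [Field K] [Algebra A K] [IsFractionRing A K] {y : A}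
    (hy0 : y ≠ 0) (hy : ¬ IsUnit y) :
    ∃ B : ValuationSubring K, IsDiscreteValuationRing B ∧ (∀ a, algebraMap A K a ∈ B) ∧
      (algebraMap A K y)⁻¹ ∉ B := by
  obtain ⟨p, hp⟩ := (Ideal.span {y}).nonempty_minimalPrimes
    (by simpa [Ideal.span_singleton_eq_top] using hy)
  have hpp : p.IsPrime := hp.1.1
  have hyp : y ∈ p := hp.1.2 (Ideal.mem_span_singleton_self y)
  let Ap := Localization.AtPrime p
  have : IsNoetherianRing Ap := IsLocalization.isNoetherianRing p.primeCompl Ap inferInstance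
  have hdom : IsDomain Ap :=
    IsLocalization.isDomain_localization p.primeCompl_le_nonZeroDivisors
  have : Ring.KrullDimLE 1 Ap := by
    rw [Ring.krullDimLE_iff, IsLocalization.AtPrime.ringKrullDim_eq_height p Ap]
    exact_mod_cast Ideal.height_le_one_of_isPrincipal_of_mem_minimalPrimes _ p hp
  have hinjK : Function.Injective (algebraMap A K) := IsFractionRing.injective A K
  have hunit (c : p.primeCompl) : IsUnit (algebraMap A K c) :=
    IsUnit.mk0 _ ((map_ne_zero_iff _ hinjK).mpr fun h ↦ c.2 (h ▸ p.zero_mem))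
  let f : Ap →+* K := IsLocalization.lift (M := p.primeCompl) hunit
  have hf (a : A) : f (algebraMap A Ap a) = algebraMap A K a := IsLocalization.lift_eq hunit a
  have hfinj : Function.Injective f :=
    (IsLocalization.lift_injective_iff hunit).mpr fun a b ↦ by
      rw [hinjK.eq_iff, (IsLocalization.injective Ap p.primeCompl_le_nonZeroDivisors).eq_iff]
  obtain ⟨B, hB, hloc⟩ := IsLocalRing.exists_factor_valuationRing f
  let j : Ap →+* B := f.codRestrict B.toSubring hB
  let _ : Algebra Ap B := j.toAlgebra
  have hj (c : Ap) : (algebraMap Ap B c : K) = f c := rfl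
  have hnoeth : IsNoetherianRing B := by
    refine isNoetherianRing_of_krullDimLE_one (A := Ap) (fun c d h ↦ hfinj ?_) fun w ↦ ?_
    · rw [← hj, ← hj, h]
    · obtain ⟨r, q, hq, h⟩ := IsFractionRing.div_surjective (A := A) (w : K)
      have hq0 : q ≠ 0 := nonZeroDivisors.ne_zero hq
      refine ⟨algebraMap A Ap q, (map_ne_zero_iff _ (IsLocalization.injective Ap
        p.primeCompl_le_nonZeroDivisors)).mpr hq0, algebraMap A Ap r, Subtype.ext ?_⟩
      change f (algebraMap A Ap q) * (w : K) = f (algebraMap A Ap r)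
      rw [hf, hf, ← h, mul_div_cancel₀ _ ((map_ne_zero_iff _ hinjK).mpr hq0)]
  have hyB : ¬ IsUnit (j (algebraMap A Ap y)) := by
    intro h
    have := hloc.map_nonunit _ h
    rw [IsLocalization.AtPrime.isUnit_to_map_iff Ap p] at this
    exact this hyp
  have hyK : (j (algebraMap A Ap y) : K) = algebraMap A K y := hf y
  have hy0K : algebraMap A K y ≠ 0 := (map_ne_zero_iff _ hinjK).mpr hy0
  have hinv : (algebraMap A K y)⁻¹ ∉ B := fun h ↦ hyB (IsUnit.of_mul_eq_one ⟨_, h⟩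
    (Subtype.ext (by
      change (j (algebraMap A Ap y) : K) * _ = 1
      rw [hyK, mul_inv_cancel₀ hy0K])))
  have hfield : ¬ IsField B := fun h ↦ hyB (by
    let _ := h.toField
    exact IsUnit.mk0 _ fun h0 ↦ hy0K (by rw [← hyK, h0]; rfl))
  refine ⟨B, ?_, fun a ↦ hf a ▸ hB _, hinv⟩
  have hV : ValuationRing B := inferInstance
  exact ((IsDiscreteValuationRing.TFAE B hfield).out 0 1 :
    IsDiscreteValuationRing B ↔ ValuationRing B).mpr hV

/-- The valuative criterion with discrete valuation rings: an element `x` of a domain that is not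
integral over a Noetherian ring `A` is separated from the image of `A` by some discrete
valuation ring: inside a field `K` that contains `B`, the ring contains the image of `A` but not
`x`. The valuation ring comes from the nonunit `x⁻¹` of `A[x⁻¹]`. -/
theorem exists_isDiscreteValuationRing_of_not_isIntegral {A B : Type u} [CommRing A]
    [IsNoetherianRing A] [CommRing B] [IsDomain B] [Algebra A B] {x : B}
    (hx : ¬ IsIntegral A x) :
    ∃ (V : Type max u s) (_ : CommRing V) (_ : IsDomain V) (_ : IsDiscreteValuationRing V)
      (K : Type u) (_ : Field K) (j : B →+* K) (k : A →+* V) (i : V →+* K),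
      Function.Injective j ∧ i.comp k = j.comp (algebraMap A B) ∧ ∀ z, i z ≠ j x := by
  let L := FractionRing B
  have hinj : Function.Injective (algebraMap B L) := IsFractionRing.injective B L
  have hx0 : algebraMap B L x ≠ 0 := (map_ne_zero_iff _ hinj).mpr fun h ↦
    hx (h ▸ isIntegral_zero)
  let ξ := algebraMap B L x
  let C := Algebra.adjoin A {ξ⁻¹}
  have : IsNoetherianRing C :=
    isNoetherianRing_of_fg ((Subalgebra.fg_def).mpr ⟨{ξ⁻¹}, Set.finite_singleton _, rfl⟩)
  let y : C := ⟨ξ⁻¹, Algebra.subset_adjoin rfl⟩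
  have hy0 : y ≠ 0 := fun h ↦ inv_ne_zero hx0 (congrArg Subtype.val h)
  have hy : ¬ IsUnit y := by
    intro h
    have := invertibleOfNonzero (inv_ne_zero hx0)
    by_cases hA : Subsingleton A
    · have h10 : (1 : A) = 0 := Subsingleton.elim _ _
      have : (1 : B) = 0 := by rw [← map_one (algebraMap A B), h10, map_zero]
      exact one_ne_zero this
    have hAn : Nontrivial A := not_subsingleton_iff_nontrivial.mp hA
    obtain ⟨p, hp, hpx⟩ := Algebra.exists_aeval_invOf_eq_zero_of_idealMap_adjoin_sup_span_eq_top
      ξ⁻¹ (⊥ : Ideal A) bot_ne_top (by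
        rw [Ideal.map_bot, bot_sup_eq, Ideal.span_singleton_eq_top]
        exact h)
    refine hx ⟨p, sub_eq_zero.mp (by simpa using hp), hinj ?_⟩
    rw [invOf_eq_inv, inv_inv] at hpx
    rw [map_zero, ← hpx, ← Polynomial.aeval_def, Polynomial.aeval_algebraMap_apply]
  let K₁ := FractionRing C
  obtain ⟨V, hV, hCV, hyV⟩ :=
    exists_valuationSubring_isDiscreteValuationRing (K := K₁) hy0 hy
  let e : ULift.{s} V ≃+* V := ULift.ringEquiv
  have hdom : IsDomain (ULift.{s} V) := e.toMulEquiv.isDomain V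
  let i₁ : K₁ →+* L := IsFractionRing.lift (A := C) (g := C.val.toRingHom) Subtype.val_injective
  have hi₁ (c : C) : i₁ (algebraMap C K₁ c) = c := IsFractionRing.lift_algebraMap _ c
  refine ⟨ULift.{s} V, inferInstance, hdom,
    IsDiscreteValuationRing.RingEquivClass.isDiscreteValuationRing e.symm, L, inferInstance,
    algebraMap B L,
    e.symm.toRingHom.comp (((algebraMap C K₁).codRestrict V.toSubring hCV).comp
      (algebraMap A C)), i₁.comp (V.subtype.comp e.toRingHom), hinj, ?_, fun z hz ↦ hyV ?_⟩
  · ext a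
    exact (hi₁ _).trans (IsScalarTower.algebraMap_apply A B L a)
  · have : (algebraMap C K₁ y)⁻¹ = (e z : K₁) := by
      apply i₁.injective
      rw [map_inv₀, hi₁]
      change (ξ⁻¹)⁻¹ = _
      rw [inv_inv]
      exact hz.symm
    rw [this]
    exact (e z).2

/-! ### Integrality over subalgebras -/

section Integrality

/-- The elements `ℓ x`, for `x ∈ L`, are integral over the `S`-subalgebra generated by the elements
`ℓ u` with `u ∈ U`. Here `S` need not be the ring over which `M` is a module; in the applications
`ℓ` is additive and lands in the degree one part of a symmetric algebra over `S`. -/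
def IsIntegralVia {R M : Type*} [CommRing R] [AddCommGroup M] [Module R M] (S : Type*) [CommRing S]
    {B : Type*} [CommRing B] [Algebra S B] (ℓ : M → B) (U L : Submodule R M) : Prop :=
  ∀ x ∈ L, IsIntegral (Algebra.adjoin S (ℓ '' U)) (ℓ x)

theorem IsIntegral.map_subalgebra {R S B C : Type*} [CommRing R] [CommRing S] [CommRing B]
    [CommRing C] [Algebra R B] [Algebra S C] (g : B →+* C) {A : Subalgebra R B}
    {A' : Subalgebra S C} (h : ∀ a ∈ A, g a ∈ A') {x : B} (hx : IsIntegral A x) :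
    IsIntegral A' (g x) :=
  hx.map_of_comp_eq ((g.comp A.val.toRingHom).codRestrict A' fun a ↦ h a a.2) g rfl

theorem map_mem_adjoin {S T B C : Type*} [CommRing S] [CommRing T] [CommRing B] [CommRing C]
    [Algebra S B] [Algebra T C] (g : B →+* C) (σ : S →+* T)
    (hσ : g.comp (algebraMap S B) = (algebraMap T C).comp σ) {s : Set B} {t : Set C}
    (hst : Set.MapsTo g s t) {a : B} (ha : a ∈ Algebra.adjoin S s) :
    g a ∈ Algebra.adjoin T t := by
  induction ha using Algebra.adjoin_induction with
  | mem x hx => exact Algebra.subset_adjoin (hst hx)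
  | algebraMap r =>
    rw [← RingHom.comp_apply, hσ]
    exact Subalgebra.algebraMap_mem _ _
  | add x y _ _ hx hy => rw [map_add]; exact add_mem hx hy
  | mul x y _ _ hx hy => rw [map_mul]; exact mul_mem hx hy

theorem IsIntegralVia.map {R M : Type*} [CommRing R] [AddCommGroup M] [Module R M]
    {S T B C : Type*} [CommRing S] [CommRing T] [CommRing B] [CommRing C] [Algebra S B]
    [Algebra T C] (g : B →+* C) (σ : S →+* T)
    (hσ : g.comp (algebraMap S B) = (algebraMap T C).comp σ) {ℓ : M → B} {ℓ' : M → C}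
    (hℓ : ∀ x, g (ℓ x) = ℓ' x) {U L : Submodule R M} (h : IsIntegralVia S ℓ U L) :
    IsIntegralVia T ℓ' U L := by
  intro x hx
  rw [← hℓ x]
  refine (h x hx).map_subalgebra g fun a ha ↦ map_mem_adjoin g σ hσ ?_ ha
  rintro _ ⟨u, hu, rfl⟩
  exact ⟨u, hu, (hℓ u).symm⟩

/-- Integrality can be tested in finitely many quotients with nilpotent common kernel: the product
of lifts of the integral equations is nilpotent at `x`. -/
theorem IsIntegral.of_forall_map {R B : Type*} [CommRing R] [CommRing B] [Algebra R B]
    {A : Subalgebra R B} {x : B} {ι : Type*} [Finite ι] {S C : ι → Type*}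
    [∀ q, CommRing (S q)] [∀ q, CommRing (C q)] [∀ q, Algebra (S q) (C q)]
    (g : ∀ q, B →+* C q) (A' : ∀ q, Subalgebra (S q) (C q))
    (hA' : ∀ q, ∀ c ∈ A' q, ∃ a ∈ A, g q a = c)
    (hx : ∀ q, IsIntegral (A' q) (g q x))
    (hnil : ∀ b : B, (∀ q, g q b = 0) → IsNilpotent b) : IsIntegral A x := by
  have key (q : ι) : ∃ P : Polynomial A, P.Monic ∧ g q (Polynomial.aeval x P) = 0 := by
    obtain ⟨P, hP, hPx⟩ := hx q
    let φ : A →+* C q := (g q).comp A.val.toRingHom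
    have hlift : P.map (A' q).val.toRingHom ∈ Polynomial.lifts φ := by
      rw [Polynomial.lifts_iff_coeff_lifts]
      intro n
      obtain ⟨a, ha, hac⟩ := hA' q _ (P.coeff n).2
      exact ⟨⟨a, ha⟩, by rw [Polynomial.coeff_map]; exact hac⟩
    obtain ⟨P', hP', -, hmonic⟩ :=
      Polynomial.lifts_and_natDegree_eq_and_monic hlift (hP.map _)
    refine ⟨P', hmonic, ?_⟩
    have h1 : g q (Polynomial.aeval x P') = (P'.map φ).eval (g q x) := by
      rw [Polynomial.aeval_def, Polynomial.hom_eval₂, Polynomial.eval_map]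
      rfl
    rw [h1, hP', Polynomial.eval_map]
    exact hPx
  choose P hP hPx using key
  cases nonempty_fintype ι
  obtain ⟨n, hn⟩ := hnil (Polynomial.aeval x (∏ q, P q)) fun q ↦ by
    rw [map_prod, map_prod]
    exact Finset.prod_eq_zero (Finset.mem_univ q) (hPx q)
  exact ⟨(∏ q, P q) ^ n, (Polynomial.monic_prod_of_monic _ _ fun q _ ↦ hP q).pow n, by
    rw [← Polynomial.aeval_def, map_pow, hn]⟩

theorem IsIntegralVia.of_injective {R M : Type*} [CommRing R] [AddCommGroup M] [Module R M]
    {S B C : Type*} [CommRing S] [CommRing B] [CommRing C] [Algebra S B] [Algebra S C]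
    (g : B →ₐ[S] C) (hg : Function.Injective g) {ℓ : M → B} {U L : Submodule R M}
    (h : IsIntegralVia S (g ∘ ℓ) U L) : IsIntegralVia S ℓ U L := by
  intro x hx
  refine IsIntegral.of_forall_map (ι := Unit) (S := fun _ ↦ S) (C := fun _ ↦ C)
    (fun _ ↦ g.toRingHom) (fun _ ↦ Algebra.adjoin S ((g ∘ ℓ) '' U)) (fun _ c hc ↦ ?_)
    (fun _ ↦ h x hx) fun b hb ↦ ?_
  · rw [Set.image_comp, ← AlgHom.map_adjoin] at hc
    exact hc
  · rw [(map_eq_zero_iff g hg).mp (hb ())]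
    exact IsNilpotent.zero

/-- Integrality extends from a set of elements `ℓ x` to the subalgebra they generate. -/
theorem isIntegralVia_iff_forall_mem_adjoin {R M : Type*} [CommRing R] [AddCommGroup M]
    [Module R M] {S B : Type*} [CommRing S] [CommRing B] [Algebra S B] {ℓ : M → B}
    {U L : Submodule R M} : IsIntegralVia S ℓ U L ↔
      ∀ y ∈ Algebra.adjoin S (ℓ '' L), IsIntegral (Algebra.adjoin S (ℓ '' U)) y := by
  refine ⟨fun h y hy ↦ ?_, fun h x hx ↦ h _ (Algebra.subset_adjoin ⟨x, hx, rfl⟩)⟩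
  have : Algebra.adjoin S (ℓ '' L) ≤
      (integralClosure (Algebra.adjoin S (ℓ '' U)) B).restrictScalars S :=
    Algebra.adjoin_le (by rintro _ ⟨x, hx, rfl⟩; exact h x hx)
  exact this hy

end Integrality

/-! ### Rees algebras inside symmetric algebras of free modules -/

section Rees

/-- A finitely generated submodule of a free module is fixed by an endomorphism that factors
through a free module of finite rank. -/
theorem exists_fin_retraction {R P : Type*} [CommRing R] [AddCommGroup P] [Module R P]
    [Module.Free R P] {N : Submodule R P} (hN : N.FG) :
    ∃ (n : ℕ) (p : P →ₗ[R] (Fin n → R)) (i : (Fin n → R) →ₗ[R] P), ∀ y ∈ N, i (p y) = y := by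
  classical
  obtain ⟨t, rfl⟩ := hN
  let b := Module.Free.chooseBasis R P
  let S := t.biUnion fun y ↦ (b.repr y).support
  let e := S.equivFin
  let p : P →ₗ[R] (Fin S.card → R) := LinearMap.pi fun k ↦ b.coord (e.symm k)
  let i : (Fin S.card → R) →ₗ[R] P := Fintype.linearCombination R fun k ↦ b (e.symm k)
  refine ⟨S.card, p, i, fun y hy ↦ ?_⟩
  refine LinearMap.eqOn_span (f := i ∘ₗ p) (g := LinearMap.id) (fun z hz ↦ ?_) hy
  have hsub : (b.repr z).support ⊆ S :=
    Finset.subset_biUnion_of_mem (fun y ↦ (b.repr y).support) hz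
  calc i (p z) = ∑ k, b.repr z (e.symm k) • b (e.symm k) := Fintype.linearCombination_apply ..
    _ = ∑ k : S, b.repr z k • b k := e.symm.sum_comp fun k : S ↦ b.repr z k • b k
    _ = ∑ k ∈ S, b.repr z k • b k := Finset.sum_coe_sort S fun k ↦ b.repr z k • b k
    _ = (b.repr z).sum fun k c ↦ c • b k :=
      (Finsupp.sum_of_support_subset _ hsub (fun k c ↦ c • b k) fun k _ ↦ zero_smul R (b k)).symm
    _ = z := b.linearCombination_repr z

variable {R : Type u} [CommRing R] {M : Type v} [AddCommGroup M] [Module R M]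

theorem symMap_ι {N : Type w} [AddCommGroup N] [Module R N] (φ : M →ₗ[R] N) (x : M) :
    symMap φ (SymmetricAlgebra.ι R M x) = SymmetricAlgebra.ι R N (φ x) := by
  simp [symMap]

theorem symMap_comp {N : Type w} [AddCommGroup N] [Module R N] {P : Type g} [AddCommGroup P]
    [Module R P] (ψ : N →ₗ[R] P) (φ : M →ₗ[R] N) :
    symMap (ψ ∘ₗ φ) = (symMap ψ).comp (symMap φ) := by
  apply SymmetricAlgebra.algHom_ext
  ext x
  simp [symMap_ι]

theorem ker_symMap_le_ker_symMap_comp {N : Type w} [AddCommGroup N] [Module R N] {P : Type g}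
    [AddCommGroup P] [Module R P] (ψ : N →ₗ[R] P) (φ : M →ₗ[R] N) :
    RingHom.ker (symMap φ) ≤ RingHom.ker (symMap (ψ ∘ₗ φ)) := by
  intro z hz
  rw [RingHom.mem_ker] at hz ⊢
  rw [symMap_comp, AlgHom.comp_apply, hz, map_zero]

theorem le_moduleReesIdeal_iff {I : Ideal (SymmetricAlgebra R M)} :
    I ≤ moduleReesIdeal R M ↔ ∀ (G : Type (max u v)) [AddCommGroup G] [Module R G]
      [Module.Free R G] (φ : M →ₗ[R] G), I ≤ RingHom.ker (symMap φ) := by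
  simp only [moduleReesIdeal, le_iInf_iff]

/-- For a finitely generated module, the free modules in all universes may be used in the
definition of the Rees algebra, since each map can be replaced by one to `Rⁿ`. -/
theorem moduleReesIdeal_le_ker [Module.Finite R M] {G : Type w} [AddCommGroup G] [Module R G]
    [Module.Free R G] (φ : M →ₗ[R] G) : moduleReesIdeal R M ≤ RingHom.ker (symMap φ) := by
  obtain ⟨n, p, i, h⟩ := exists_fin_retraction (R := R) (N := LinearMap.range φ)
    (Module.Finite.iff_fg.mp inferInstance)
  let e : ULift.{max u v} (Fin n → R) ≃ₗ[R] (Fin n → R) := ULift.moduleEquiv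
  have hφ : φ = (i ∘ₗ e.toLinearMap) ∘ₗ (e.symm.toLinearMap ∘ₗ p ∘ₗ φ) := by
    ext x
    simp [h (φ x) ⟨x, rfl⟩]
  rw [hφ]
  exact (le_moduleReesIdeal_iff.mp le_rfl _ _).trans (ker_symMap_le_ker_symMap_comp _ _)

theorem IsVersal.ker_symMap [Module.Finite R M] {F : Type w} [AddCommGroup F] [Module R F]
    {f : M →ₗ[R] F} (hf : IsVersal f) : RingHom.ker (symMap f) = moduleReesIdeal R M := by
  have := hf.1
  refine le_antisymm (le_moduleReesIdeal_iff.mpr fun G _ _ _ φ ↦ ?_) (moduleReesIdeal_le_ker f)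
  obtain ⟨h, rfl⟩ := hf.2 G φ
  exact ker_symMap_le_ker_symMap_comp _ _

/-- Vector spaces over the field of fractions `K` of a domain are injective modules: the extension
is obtained from a `K`-linear retraction of `K ⊗ M → K ⊗ P`, which is injective by flatness. -/
theorem exists_extend_of_injective {D : Type*} [CommRing D] [IsDomain D] {M P W : Type*}
    [AddCommGroup M] [Module D M] [AddCommGroup P] [Module D P] [AddCommGroup W] [Module D W]
    [Module (FractionRing D) W] [IsScalarTower D (FractionRing D) W] {j : M →ₗ[D] P}
    (hj : Function.Injective j) (φ : M →ₗ[D] W) : ∃ h : P →ₗ[D] W, h ∘ₗ j = φ := by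
  let K := FractionRing D
  have : Module.Flat D K := IsLocalization.flat K (nonZeroDivisors D)
  have hinj : Function.Injective (j.baseChange K) :=
    Module.Flat.lTensor_preserves_injective_linearMap (M := K) j hj
  obtain ⟨r, hr⟩ := (j.baseChange K).exists_leftInverse_of_injective (LinearMap.ker_eq_bot.mpr hinj)
  refine ⟨((φ.liftBaseChange K ∘ₗ r).restrictScalars D) ∘ₗ TensorProduct.mk D K P 1, ?_⟩
  ext x
  have := LinearMap.congr_fun hr (1 ⊗ₜ x)
  simp only [LinearMap.comp_apply, LinearMap.baseChange_tmul, LinearMap.id_apply] at this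
  simp [this]

/-- Over a domain, any embedding of a finitely generated module into a free module can be used to
compute its Rees algebra: after passage to the field of fractions, maps extend. -/
theorem ker_symMap_of_injective {D : Type u} [CommRing D] [IsDomain D] {M : Type v}
    [AddCommGroup M] [Module D M] [Module.Finite D M] {P : Type w} [AddCommGroup P] [Module D P]
    [Module.Free D P] {j : M →ₗ[D] P} (hj : Function.Injective j) :
    RingHom.ker (symMap j) = moduleReesIdeal D M := by
  refine le_antisymm (le_moduleReesIdeal_iff.mpr fun G _ _ _ φ ↦ ?_) (moduleReesIdeal_le_ker j)
  let b := Module.Free.chooseBasis D G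
  let K := FractionRing D
  let e := SymmetricAlgebra.equivMvPolynomial b
  -- `ε` embeds `Sym(G) = D[X]` into `K[X]`.
  let ε : SymmetricAlgebra D G →ₐ[D] MvPolynomial (Module.Free.ChooseBasisIndex D G) K :=
    (MvPolynomial.mapAlgHom (Algebra.ofId D K)).comp e.toAlgHom
  have hε : Function.Injective ε :=
    (MvPolynomial.map_injective _ (IsFractionRing.injective D K)).comp e.injective
  obtain ⟨h, hh⟩ := exists_extend_of_injective hj (ε.toLinearMap ∘ₗ SymmetricAlgebra.ι D G ∘ₗ φ)
  have hcomp : (SymmetricAlgebra.lift h).comp (symMap j) = ε.comp (symMap φ) := by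
    apply SymmetricAlgebra.algHom_ext
    ext1 x
    simpa [symMap_ι] using LinearMap.congr_fun hh x
  intro z hz
  rw [RingHom.mem_ker] at hz ⊢
  refine hε ?_
  rw [← AlgHom.comp_apply, ← hcomp, AlgHom.comp_apply, hz, map_zero, map_zero]

/-- The map from the Rees algebra of `M` to `Sym(P)` induced by a linear map `M → P` such that
`Sym(M) → Sym(P)` kills the ideal that defines the Rees algebra. -/
noncomputable def moduleReesLift {P : Type w} [AddCommGroup P] [Module R P] (φ : M →ₗ[R] P)
    (h : moduleReesIdeal R M ≤ RingHom.ker (symMap φ)) :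
    ModuleReesAlgebra R M →ₐ[R] SymmetricAlgebra R P :=
  Ideal.Quotient.liftₐ _ (symMap φ) fun _ ha ↦ h ha

theorem moduleReesLift_toModuleRees {P : Type w} [AddCommGroup P] [Module R P] (φ : M →ₗ[R] P)
    (h : moduleReesIdeal R M ≤ RingHom.ker (symMap φ)) (x : M) :
    moduleReesLift φ h (toModuleRees R M x) = SymmetricAlgebra.ι R P (φ x) :=
  symMap_ι φ x

theorem moduleReesLift_injective {P : Type w} [AddCommGroup P] [Module R P] (φ : M →ₗ[R] P)
    (h : RingHom.ker (symMap φ) = moduleReesIdeal R M) :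
    Function.Injective (moduleReesLift φ h.ge) :=
  (injective_iff_map_eq_zero _).mpr fun z hz ↦ by
    obtain ⟨z, rfl⟩ := Ideal.Quotient.mk_surjective z
    exact Ideal.Quotient.eq_zero_iff_mem.mpr (h.le hz)

theorem isIntegralIn_iff_isIntegralVia_toModuleRees {U L : Submodule R M} :
    IsIntegralIn U L ↔ IsIntegralVia R (toModuleRees R M) U L := by
  rw [isIntegralVia_iff_forall_mem_adjoin]
  rfl

theorem IsIntegralIn.isIntegralVia [Module.Finite R M] {P : Type w} [AddCommGroup P] [Module R P]
    [Module.Free R P] (φ : M →ₗ[R] P) {U L : Submodule R M} (h : IsIntegralIn U L) :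
    IsIntegralVia R (fun x ↦ SymmetricAlgebra.ι R P (φ x)) U L :=
  (isIntegralIn_iff_isIntegralVia_toModuleRees.mp h).map
    (moduleReesLift φ (moduleReesIdeal_le_ker φ)).toRingHom (RingHom.id R)
    (by ext r; exact AlgHom.commutes _ r) (moduleReesLift_toModuleRees φ _)

theorem isIntegralIn_iff_isIntegralVia [Module.Finite R M] {P : Type w} [AddCommGroup P]
    [Module R P] [Module.Free R P] {φ : M →ₗ[R] P}
    (hφ : RingHom.ker (symMap φ) = moduleReesIdeal R M) {U L : Submodule R M} :
    IsIntegralIn U L ↔ IsIntegralVia R (fun x ↦ SymmetricAlgebra.ι R P (φ x)) U L := by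
  refine ⟨fun h ↦ h.isIntegralVia φ, fun h ↦ ?_⟩
  rw [isIntegralIn_iff_isIntegralVia_toModuleRees]
  refine IsIntegralVia.of_injective (moduleReesLift φ hφ.ge) (moduleReesLift_injective φ hφ) ?_
  convert h using 2 with x
  exact moduleReesLift_toModuleRees φ _ _

/-- Integrality within a finitely generated submodule `M'` of a module `P₀` over a domain is tested
on generators, in the symmetric algebra of any free module `P` in which `P₀` embeds. -/
theorem isIntegralWithin_iff_isIntegralVia {D : Type u} [CommRing D] [IsDomain D] {P₀ : Type v}
    [AddCommGroup P₀] [Module D P₀] {P : Type w} [AddCommGroup P] [Module D P] [Module.Free D P]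
    {j : P₀ →ₗ[D] P} (hj : Function.Injective j) {U' L' M' : Submodule D P₀} (hUM : U' ≤ M')
    (hLM : L' ≤ M') [Module.Finite D M'] {R M : Type*} [CommRing R] [AddCommGroup M] [Module R M]
    {U L : Submodule R M} {e : M → P₀} (hU : U' = Submodule.span D (e '' U))
    (hL : L' = Submodule.span D (e '' L)) :
    IsIntegralWithin U' L' M' ↔
      IsIntegralVia D (fun x ↦ SymmetricAlgebra.ι D P (j (e x))) U L := by
  have hinj : Function.Injective (j ∘ₗ M'.subtype) := hj.comp M'.subtype_injective
  have himage {N' : Submodule D P₀} (hN : N' ≤ M') {N : Submodule R M}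
      (hspan : N' = Submodule.span D (e '' N)) :
      Algebra.adjoin D ((fun x ↦ SymmetricAlgebra.ι D P ((j ∘ₗ M'.subtype) x)) ''
        (N'.submoduleOf M' : Set M')) =
      Algebra.adjoin D ((fun x ↦ SymmetricAlgebra.ι D P (j (e x))) '' N) := by
    have h1 : (fun x ↦ SymmetricAlgebra.ι D P ((j ∘ₗ M'.subtype) x)) ''
        (N'.submoduleOf M' : Set M') =
        (N'.map (SymmetricAlgebra.ι D P ∘ₗ j) : Set (SymmetricAlgebra D P)) := by
      ext z
      constructor
      · rintro ⟨y, hy, rfl⟩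
        exact ⟨y, hy, rfl⟩
      · rintro ⟨y, hy, rfl⟩
        exact ⟨⟨y, hN hy⟩, hy, rfl⟩
    rw [h1, hspan, Submodule.map_span, Algebra.adjoin_span, ← Set.image_comp]
    rfl
  rw [IsIntegralWithin, isIntegralIn_iff_isIntegralVia (ker_symMap_of_injective hinj),
    isIntegralVia_iff_forall_mem_adjoin, isIntegralVia_iff_forall_mem_adjoin,
    himage hUM hU, himage hLM hL]

end Rees

/-! ### Images in base changes of free modules -/

section Images

variable {R : Type u} [CommRing R] {M : Type v} [AddCommGroup M] [Module R M]
  {G : Type w} [AddCommGroup G] [Module R G]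

theorem imageTensor_eq_span (S : Type s) [CommRing S] [Algebra R S] (φ : M →ₗ[R] G)
    (U : Submodule R M) :
    imageTensor S φ U = Submodule.span S ((fun x ↦ (1 : S) ⊗ₜ[R] φ x) '' U) := by
  apply le_antisymm
  · rintro _ ⟨z, rfl⟩
    induction z with
    | zero => rw [map_zero]; exact zero_mem _
    | add a b ha hb => rw [map_add]; exact add_mem ha hb
    | tmul c x =>
      rw [LinearMap.baseChange_tmul, ← mul_one c, ← smul_eq_mul, ← TensorProduct.smul_tmul']
      exact Submodule.smul_mem _ _ (Submodule.subset_span ⟨x, x.2, rfl⟩)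
  · rw [Submodule.span_le]
    rintro _ ⟨x, hx, rfl⟩
    exact ⟨1 ⊗ₜ ⟨x, hx⟩, by simp⟩

theorem tmul_mem_imageTensor (S : Type s) [CommRing S] [Algebra R S] (φ : M →ₗ[R] G)
    {U : Submodule R M} {x : M} (hx : x ∈ U) : (1 : S) ⊗ₜ[R] φ x ∈ imageTensor S φ U := by
  rw [imageTensor_eq_span]
  exact Submodule.subset_span ⟨x, hx, rfl⟩

theorem imageTensor_mono (S : Type s) [CommRing S] [Algebra R S] (φ : M →ₗ[R] G)
    {U L : Submodule R M} (h : U ≤ L) : imageTensor S φ U ≤ imageTensor S φ L := by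
  rw [imageTensor_eq_span, imageTensor_eq_span]
  exact Submodule.span_mono (Set.image_mono h)

theorem imageTensor_comp (S : Type s) [CommRing S] [Algebra R S] {G' : Type g} [AddCommGroup G']
    [Module R G'] (ψ : G →ₗ[R] G') (φ : M →ₗ[R] G) (U : Submodule R M) :
    imageTensor S (ψ ∘ₗ φ) U = (imageTensor S φ U).map (ψ.baseChange S) := by
  rw [imageTensor_eq_span, imageTensor_eq_span, Submodule.map_span, ← Set.image_comp]
  simp [Function.comp_def]

theorem imageTensor_le_of_forall_mem {S : Type s} [CommRing S] [Algebra R S] {φ : M →ₗ[R] G}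
    {L : Submodule R M} {N : Submodule S (S ⊗[R] G)} (h : ∀ x ∈ L, (1 : S) ⊗ₜ[R] φ x ∈ N) :
    imageTensor S φ L ≤ N := by
  rw [imageTensor_eq_span, Submodule.span_le]
  rintro _ ⟨x, hx, rfl⟩
  exact h x hx

theorem isIntegralWithin_imageTensor_iff [Module.Finite R M] [Module.Free R G] {S : Type s}
    [CommRing S] [IsDomain S] [Algebra R S] (φ : M →ₗ[R] G) (U L : Submodule R M) :
    IsIntegralWithin (imageTensor S φ U) (imageTensor S φ L) (imageTensor S φ ⊤) ↔
      IsIntegralVia S (fun x ↦ SymmetricAlgebra.ι S (S ⊗[R] G) (1 ⊗ₜ φ x)) U L := by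
  have : Module.Finite R (⊤ : Submodule R M) := Module.Finite.iff_fg.mpr Module.Finite.fg_top
  have : Module.Finite S (imageTensor S φ ⊤) := Module.Finite.range _
  exact isIntegralWithin_iff_isIntegralVia (j := LinearMap.id) Function.injective_id
    (imageTensor_mono S φ le_top) (imageTensor_mono S φ le_top)
    (imageTensor_eq_span S φ U) (imageTensor_eq_span S φ L)

theorem imageMod_eq_span (Q : Ideal R) (f : M →ₗ[R] G) (U : Submodule R M) :
    imageMod Q f U =
      Submodule.span (R ⧸ Q) ((fun x ↦ (Q • ⊤ : Submodule R G).mkQ (f x)) '' U) :=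
  (Submodule.span_eq (imageMod Q f U)).symm

theorem imageMod_mono (Q : Ideal R) (f : M →ₗ[R] G) {U L : Submodule R M} (h : U ≤ L) :
    imageMod Q f U ≤ imageMod Q f L :=
  Set.image_mono h

theorem finite_imageMod_top [Module.Finite R M] (Q : Ideal R) (f : M →ₗ[R] G) :
    Module.Finite (R ⧸ Q) (imageMod Q f ⊤) := by
  classical
  obtain ⟨t, ht⟩ := Module.Finite.fg_top (R := R) (M := M)
  refine Module.Finite.iff_fg.mpr
    ⟨t.image fun x ↦ (Q • ⊤ : Submodule R G).mkQ (f x), le_antisymm ?_ ?_⟩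
  · rw [Submodule.span_le, Finset.coe_image]
    rintro _ ⟨x, -, rfl⟩
    exact ⟨x, trivial, rfl⟩
  · rintro _ ⟨x, -, rfl⟩
    have hx : x ∈ Submodule.span R (t : Set M) := ht ▸ Submodule.mem_top
    change (Q • ⊤ : Submodule R G).mkQ (f x) ∈ _
    induction hx using Submodule.span_induction with
    | mem x hx =>
      exact Submodule.subset_span (Finset.mem_coe.mpr (Finset.mem_image_of_mem _ hx))
    | zero => rw [map_zero, map_zero]; exact zero_mem _
    | add x y _ _ hx hy => rw [map_add, map_add]; exact add_mem hx hy
    | smul c x _ hx =>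
      rw [map_smul, map_smul]
      exact Submodule.smul_mem _ (Ideal.Quotient.mk Q c) hx

theorem isIntegralWithin_imageMod_iff [Module.Finite R M] [Module.Free R G] (Q : Ideal R)
    [Q.IsPrime] (f : M →ₗ[R] G) (U L : Submodule R M) :
    IsIntegralWithin (imageMod Q f U) (imageMod Q f L) (imageMod Q f ⊤) ↔
      IsIntegralVia (R ⧸ Q)
        (fun x ↦ SymmetricAlgebra.ι (R ⧸ Q) ((R ⧸ Q) ⊗[R] G) (1 ⊗ₜ f x)) U L := by
  have := finite_imageMod_top Q f
  let e : (G ⧸ (Q • ⊤ : Submodule R G)) ≃ₗ[R ⧸ Q] (R ⧸ Q) ⊗[R] G :=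
    (TensorProduct.quotTensorEquivQuotSMul G Q).symm.extendScalarsOfSurjective
      Ideal.Quotient.mk_surjective
  have he (x : G) : e ((Q • ⊤ : Submodule R G).mkQ x) = 1 ⊗ₜ x :=
    TensorProduct.quotTensorEquivQuotSMul_symm_mk Q x
  rw [isIntegralWithin_iff_isIntegralVia (j := e.toLinearMap) e.injective
    (imageMod_mono Q f le_top) (imageMod_mono Q f le_top)
    (imageMod_eq_span Q f U) (imageMod_eq_span Q f L)]
  simp only [LinearEquiv.coe_coe, he]

end Images

/-! ### From the module to its base changes -/

section BaseChange

variable {R : Type u} [CommRing R] {M : Type v} [AddCommGroup M] [Module R M]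
  {G : Type w} [AddCommGroup G] [Module R G]

theorem IsIntegralVia.baseChange {φ : M →ₗ[R] G} {U L : Submodule R M} (S : Type s) [CommRing S]
    [Algebra R S] (h : IsIntegralVia R (fun x ↦ SymmetricAlgebra.ι R G (φ x)) U L) :
    IsIntegralVia S (fun x ↦ SymmetricAlgebra.ι S (S ⊗[R] G) (1 ⊗ₜ φ x)) U L := by
  let g : SymmetricAlgebra R G →ₐ[R] SymmetricAlgebra S (S ⊗[R] G) :=
    SymmetricAlgebra.lift ((SymmetricAlgebra.ι S (S ⊗[R] G)).restrictScalars R ∘ₗ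
      TensorProduct.mk R S G 1)
  refine h.map g.toRingHom (algebraMap R S) (by
    ext r
    exact (g.commutes r).trans (IsScalarTower.algebraMap_apply R S _ r)) fun x ↦ ?_
  exact SymmetricAlgebra.lift_ι_apply (R := R) _ _

end BaseChange

/-! ### Integral elements over discrete valuation rings -/

section Separation

variable {V : Type u} [CommRing V] [IsDomain V] [IsDiscreteValuationRing V]

theorem exists_forall_mem_range_and_notMem_range_of_fin {n : ℕ} {N : Submodule V (Fin n → V)}
    {x : Fin n → V} (hx : x ∉ N) : ∃ l : (Fin n → V) →ₗ[V] FractionRing V,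
      (∀ y ∈ N, l y ∈ (algebraMap V (FractionRing V)).range) ∧
        l x ∉ (algebraMap V (FractionRing V)).range := by
  let K := FractionRing V
  have hinj : Function.Injective (algebraMap V K) := IsFractionRing.injective V K
  obtain ⟨m, ⟨b, c, e, a, hca⟩⟩ := N.smithNormalForm (Pi.basisFun V (Fin n))
  let snf : Module.Basis.SmithNormalForm N (Fin n) m := ⟨b, c, e, a, hca⟩
  -- It suffices to find a coordinate and a nonzero `d` that divides it on `N` but not at `x`.
  suffices h : ∃ (k : Fin n) (d : V), d ≠ 0 ∧ (∀ y ∈ N, d ∣ b.repr y k) ∧ ¬ d ∣ b.repr x k by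
    obtain ⟨k, d, hd, hdN, hdx⟩ := h
    have hdK : algebraMap V K d ≠ 0 := (map_ne_zero_iff _ hinj).mpr hd
    refine ⟨(LinearMap.mulLeft V (algebraMap V K d)⁻¹) ∘ₗ Algebra.linearMap V K ∘ₗ b.coord k,
      fun y hy ↦ ?_, ?_⟩
    · obtain ⟨t, ht⟩ := hdN y hy
      refine ⟨t, ?_⟩
      simp only [LinearMap.comp_apply, LinearMap.mulLeft_apply, Module.Basis.coord_apply, ht,
        Algebra.linearMap_apply, map_mul]
      rw [inv_mul_cancel_left₀ hdK]
    · rintro ⟨t, ht⟩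
      refine hdx ⟨t, hinj ?_⟩
      simp only [LinearMap.comp_apply, LinearMap.mulLeft_apply, Module.Basis.coord_apply,
        Algebra.linearMap_apply] at ht
      rw [map_mul, ht, mul_inv_cancel_left₀ hdK]
  by_contra! hcon
  have ha0 (i : Fin m) : a i ≠ 0 := fun h0 ↦ c.ne_zero i (Subtype.ext (by rw [hca, h0]; simp))
  have hdiv (i : Fin m) : a i ∣ b.repr x (e i) := hcon (e i) (a i) (ha0 i) fun y hy ↦
    ⟨c.repr ⟨y, hy⟩ i, (snf.repr_apply_embedding_eq_repr_smul ⟨y, hy⟩ (i := i)).trans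
      (by rw [map_smul]; rfl)⟩
  have hzero (k : Fin n) (hk : k ∉ Set.range e) : b.repr x k = 0 := by
    by_contra h0
    obtain ⟨ϖ, hϖ⟩ := IsDiscreteValuationRing.exists_irreducible V
    obtain ⟨t, ht⟩ := hcon k (ϖ * b.repr x k) (mul_ne_zero hϖ.ne_zero h0) fun y hy ↦ by
      have : b.repr y k = 0 := snf.repr_eq_zero_of_notMem_range ⟨y, hy⟩ hk
      rw [this]
      exact dvd_zero _
    refine hϖ.not_isUnit (IsUnit.of_mul_eq_one t (mul_right_cancel₀ h0 ?_))
    linear_combination -ht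
  refine hx ?_
  rw [← b.sum_repr x]
  refine sum_mem fun k _ ↦ ?_
  by_cases hk : k ∈ Set.range e
  · obtain ⟨i, rfl⟩ := hk
    obtain ⟨t, ht⟩ := hdiv i
    rw [ht, mul_comm, mul_smul, ← hca]
    exact N.smul_mem _ (c i).2
  · rw [hzero k hk, zero_smul]
    exact N.zero_mem

/-- A finitely generated submodule `N` of a free module over a discrete valuation ring `V` is the
intersection of the sets `l⁻¹(V)`, over the linear functionals `l` with values in the field of
fractions that map `N` into `V`. -/
theorem exists_forall_mem_range_and_notMem_range {P : Type v} [AddCommGroup P] [Module V P]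
    [Module.Free V P] {N : Submodule V P} (hN : N.FG) {x : P} (hx : x ∉ N) :
    ∃ l : P →ₗ[V] FractionRing V,
      (∀ y ∈ N, l y ∈ (algebraMap V (FractionRing V)).range) ∧
        l x ∉ (algebraMap V (FractionRing V)).range := by
  obtain ⟨n, p, i, h⟩ := exists_fin_retraction (hN.sup (Submodule.fg_span_singleton x))
  have hx' : p x ∉ N.map p := by
    rintro ⟨y, hy, hyx⟩
    refine hx ?_
    rw [← h x (Submodule.mem_sup_right (Submodule.mem_span_singleton_self x)), ← hyx,
      h y (Submodule.mem_sup_left hy)]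
    exact hy
  obtain ⟨l, hlN, hlx⟩ := exists_forall_mem_range_and_notMem_range_of_fin hx'
  exact ⟨l ∘ₗ p, fun y hy ↦ hlN _ ⟨y, hy, rfl⟩, hlx⟩

/-- A linear form that is integral over `V[N]` lies in `N`: a functional as above with
values in the field of fractions of `V` maps `V[N]` to `V`, and `V` is integrally closed. -/
theorem mem_of_isIntegral_adjoin_image {P : Type v} [AddCommGroup P] [Module V P]
    [Module.Free V P] {N : Submodule V P} (hN : N.FG) {s : Set P} (hs : s ⊆ N) {x : P}
    (hx : IsIntegral (Algebra.adjoin V (SymmetricAlgebra.ι V P '' s))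
      (SymmetricAlgebra.ι V P x)) : x ∈ N := by
  by_contra hxN
  obtain ⟨l, hlN, hlx⟩ := exists_forall_mem_range_and_notMem_range hN hxN
  let K := FractionRing V
  have hle : ∀ a ∈ Algebra.adjoin V (SymmetricAlgebra.ι V P '' s),
      SymmetricAlgebra.lift l a ∈ (⊥ : Subalgebra V K) := by
    intro a ha
    have : Algebra.adjoin V (SymmetricAlgebra.ι V P '' s) ≤
        (⊥ : Subalgebra V K).comap (SymmetricAlgebra.lift l) := by
      refine Algebra.adjoin_le ?_
      rintro _ ⟨y, hy, rfl⟩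
      rw [SetLike.mem_coe, Subalgebra.mem_comap, SymmetricAlgebra.lift_ι_apply]
      exact Algebra.mem_bot.mpr (hlN y (hs hy))
    exact this ha
  have h1 : IsIntegral (⊥ : Subalgebra V K) (l x) := by
    rw [← SymmetricAlgebra.lift_ι_apply l x]
    exact hx.map_subalgebra (SymmetricAlgebra.lift l).toRingHom hle
  have h2 : IsIntegral V (l x) := isIntegral_trans (A := (⊥ : Subalgebra V K)) (l x) h1
  exact hlx (IsIntegrallyClosed.isIntegral_iff.mp h2)

variable {R : Type w} [CommRing R] [IsNoetherianRing R] [Algebra R V] {M : Type v} [AddCommGroup M]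
  [Module R M] [Module.Finite R M] {G : Type g} [AddCommGroup G] [Module R G] [Module.Free R G]

theorem IsIntegralVia.imageTensor_eq {φ : M →ₗ[R] G} {U L : Submodule R M} (hUL : U ≤ L)
    (h : IsIntegralVia V (fun x ↦ SymmetricAlgebra.ι V (V ⊗[R] G) (1 ⊗ₜ φ x)) U L) :
    imageTensor V φ U = imageTensor V φ L := by
  refine le_antisymm (imageTensor_mono V φ hUL) (imageTensor_le_of_forall_mem fun x hx ↦ ?_)
  have : Module.Finite R U := Module.Finite.iff_fg.mpr (IsNoetherian.noetherian U)
  refine mem_of_isIntegral_adjoin_image (s := (fun x ↦ (1 : V) ⊗ₜ[R] φ x) '' U)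
    (Module.Finite.iff_fg.mp (Module.Finite.range _)) ?_ ?_
  · rintro _ ⟨u, hu, rfl⟩
    exact tmul_mem_imageTensor V φ hu
  · rw [← Set.image_comp]
    exact h x hx

end Separation

/-! ### Reduction to the minimal primes -/

section MinimalPrimes

variable {R : Type u} [CommRing R]

/-- The vector `y`, written as a linear form in the variables `X₁, …, Xₙ` with coefficients reduced
modulo `Q`. -/
noncomputable def linearFormMod {n : ℕ} (Q : Ideal R) :
    (Fin n → R) →ₗ[R] MvPolynomial (Fin n) (R ⧸ Q) :=
  Fintype.linearCombination R MvPolynomial.X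

variable [IsNoetherianRing R] {M : Type v} [AddCommGroup M] [Module R M]
  {F : Type w} [AddCommGroup F] [Module R F]

/-- If the images of `U` and `L` agree over every discrete valuation ring whose kernel over `R` is
the prime `Q`, then `L` is integral over `U` modulo `Q`. Otherwise some linear form `ℓ x`, `x ∈ L`,
lies outside a discrete valuation ring that contains `R / Q` and all `ℓ u`, `u ∈ U`. -/
theorem isIntegralVia_quotient_of_forall_imageTensor_eq [Module.Finite R M] [Module.Free R F]
    {f : M →ₗ[R] F} {U L : Submodule R M} (Q : Ideal R) [Q.IsPrime]
    (h : ∀ (V : Type (max u s)) [CommRing V] [IsDomain V] [IsDiscreteValuationRing V]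
      [Algebra R V], RingHom.ker (algebraMap R V) = Q → imageTensor V f U = imageTensor V f L) :
    IsIntegralVia (R ⧸ Q)
      (fun x ↦ SymmetricAlgebra.ι (R ⧸ Q) ((R ⧸ Q) ⊗[R] F) (1 ⊗ₜ f x)) U L := by
  let D := R ⧸ Q
  obtain ⟨n, p, i, hpi⟩ := exists_fin_retraction (R := R) (N := LinearMap.range f)
    (Module.Finite.iff_fg.mp inferInstance)
  let ℓ : M →ₗ[R] MvPolynomial (Fin n) D := linearFormMod Q ∘ₗ p ∘ₗ f
  have hmain : IsIntegralVia D ℓ U L := by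
    intro x hx
    by_contra hxint
    let A := Algebra.adjoin D (ℓ '' U)
    have hA : A.FG := by
      obtain ⟨t, ht⟩ := IsNoetherian.noetherian U
      classical
      refine ⟨t.image ℓ, le_antisymm (Algebra.adjoin_mono ?_) (Algebra.adjoin_le ?_)⟩
      · rw [Finset.coe_image]
        exact Set.image_mono (ht ▸ Submodule.subset_span)
      · rintro _ ⟨y, hy, rfl⟩
        rw [SetLike.mem_coe, ← ht] at hy
        induction hy using Submodule.span_induction with
        | mem y hy =>
          exact Algebra.subset_adjoin (Finset.mem_coe.mpr (Finset.mem_image_of_mem _ hy))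
        | zero => rw [map_zero]; exact zero_mem _
        | add y z _ _ hy hz => rw [map_add]; exact add_mem hy hz
        | smul c y _ hy =>
          rw [map_smul]
          exact Subalgebra.smul_mem _ hy (Ideal.Quotient.mk Q c)
    have : IsNoetherianRing A := isNoetherianRing_of_fg hA
    obtain ⟨V, _, _, _, K, _, j, k, ν, hj, hcomp, hxV⟩ :=
      exists_isDiscreteValuationRing_of_not_isIntegral.{u, s} hxint
    let _ : Algebra R V := ((k.comp (algebraMap D A)).comp (Ideal.Quotient.mk Q)).toAlgebra
    let _ : Algebra V K := ν.toAlgebra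
    let _ : Algebra R K := (ν.comp (algebraMap R V)).toAlgebra
    have : IsScalarTower R V K := IsScalarTower.of_algebraMap_eq fun _ ↦ rfl
    have hνk (a : A) : ν (k a) = j a := RingHom.congr_fun hcomp a
    have hRK (r : R) : algebraMap R K r = j (algebraMap R (MvPolynomial (Fin n) D) r) :=
      (hνk _).trans rfl
    have hker : RingHom.ker (algebraMap R V) = Q := by
      ext r
      have hr : algebraMap R V r = k (algebraMap D A (Ideal.Quotient.mk Q r)) := rfl
      rw [RingHom.mem_ker, ← Ideal.Quotient.eq_zero_iff_mem]
      refine ⟨fun h0 ↦ ?_, fun h0 ↦ by rw [hr, h0, map_zero, map_zero]⟩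
      have h1 : j (MvPolynomial.C (Ideal.Quotient.mk Q r)) = 0 :=
        (hνk _).symm.trans (by rw [← hr, h0, map_zero])
      exact MvPolynomial.C_eq_zero.mp ((map_eq_zero_iff j hj).mp h1)
    let κ : MvPolynomial (Fin n) D →ₗ[R] K :=
      { j.toAddMonoidHom with
        map_smul' := fun r z ↦ by
          change j (r • z) = r • j z
          rw [Algebra.smul_def, Algebra.smul_def, map_mul, hRK] }
    let Λ : V ⊗[R] F →ₗ[V] K := (κ ∘ₗ linearFormMod Q ∘ₗ p).liftBaseChange V
    have hΛ (y : M) : Λ (1 ⊗ₜ f y) = j (ℓ y) := by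
      rw [LinearMap.liftBaseChange_tmul, one_smul]
      rfl
    have hle : imageTensor V f U ≤ (LinearMap.range (Algebra.linearMap V K)).comap Λ :=
      imageTensor_le_of_forall_mem fun u hu ↦ by
        rw [Submodule.mem_comap, hΛ]
        exact ⟨k ⟨ℓ u, Algebra.subset_adjoin ⟨u, hu, rfl⟩⟩, hνk _⟩
    rw [h V hker] at hle
    obtain ⟨z, hz⟩ := hle (tmul_mem_imageTensor V f hx)
    exact hxV z (hz.trans (hΛ x))
  -- Linear forms in `X₁, …, Xₙ` are mapped back to the symmetric algebra of `F / QF`.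
  let g : MvPolynomial (Fin n) D →ₐ[D] SymmetricAlgebra D (D ⊗[R] F) :=
    MvPolynomial.aeval fun k ↦ SymmetricAlgebra.ι D (D ⊗[R] F) (1 ⊗ₜ i (Pi.single k 1))
  refine hmain.map g.toRingHom (RingHom.id D) (by ext r; exact g.commutes _) fun x ↦ ?_
  have hg : (g.toLinearMap.restrictScalars R) ∘ₗ linearFormMod Q =
      ((SymmetricAlgebra.ι D (D ⊗[R] F)).restrictScalars R) ∘ₗ TensorProduct.mk R D F 1 ∘ₗ i := by
    refine LinearMap.pi_ext' fun k ↦ LinearMap.ext_ring ?_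
    simp [linearFormMod, Fintype.linearCombination_apply_single, g]
  have := LinearMap.congr_fun hg (p (f x))
  simp only [LinearMap.comp_apply, TensorProduct.mk_apply, hpi (f x) ⟨x, rfl⟩] at this
  exact this

/-- Integrality modulo all minimal primes implies integrality: the kernels of the maps
`R[X] → (R / Q)[X]` have nilpotent intersection, and there are finitely many of them. -/
theorem isIntegralVia_of_forall_minimalPrimes [Module.Free R F] {f : M →ₗ[R] F}
    {U L : Submodule R M}
    (h : ∀ Q ∈ minimalPrimes R, IsIntegralVia (R ⧸ Q)
      (fun x ↦ SymmetricAlgebra.ι (R ⧸ Q) ((R ⧸ Q) ⊗[R] F) (1 ⊗ₜ f x)) U L) :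
    IsIntegralVia R (fun x ↦ SymmetricAlgebra.ι R F (f x)) U L := by
  have hfin : Finite (minimalPrimes R) := minimalPrimes.finite_of_isNoetherianRing R
  let b := Module.Free.chooseBasis R F
  let e := SymmetricAlgebra.equivMvPolynomial b
  let π (Q : minimalPrimes R) : SymmetricAlgebra R F →ₐ[R]
      MvPolynomial (Module.Free.ChooseBasisIndex R F) (R ⧸ Q.1) :=
    (MvPolynomial.mapAlgHom (Ideal.Quotient.mkₐ R Q.1)).comp e.toAlgHom
  let ℓ : M →ₗ[R] SymmetricAlgebra R F := SymmetricAlgebra.ι R F ∘ₗ f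
  have hπ (Q : minimalPrimes R) : IsIntegralVia (R ⧸ Q.1) (fun x ↦ π Q (ℓ x)) U L := by
    let g : SymmetricAlgebra (R ⧸ Q.1) ((R ⧸ Q.1) ⊗[R] F) →ₐ[R ⧸ Q.1]
        MvPolynomial (Module.Free.ChooseBasisIndex R F) (R ⧸ Q.1) :=
      SymmetricAlgebra.lift
        (((π Q).toLinearMap ∘ₗ SymmetricAlgebra.ι R F).liftBaseChange (R ⧸ Q.1))
    refine (h Q Q.2).map g.toRingHom (RingHom.id _) (by ext r; exact congrArg _ (g.commutes _))
      fun x ↦ ?_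
    refine (SymmetricAlgebra.lift_ι_apply _ _).trans ?_
    rw [LinearMap.liftBaseChange_tmul, one_smul]
    rfl
  intro x hx
  refine IsIntegral.of_forall_map (S := fun Q : minimalPrimes R ↦ R ⧸ Q.1)
    (fun Q ↦ (π Q).toRingHom) (fun Q ↦ Algebra.adjoin (R ⧸ Q.1) ((fun x ↦ π Q (ℓ x)) '' U))
    (fun Q c hc ↦ ?_) (fun Q ↦ hπ Q x hx) fun z hz ↦ ?_
  · induction hc using Algebra.adjoin_induction with
    | mem c hc =>
      obtain ⟨u, hu, rfl⟩ := hc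
      exact ⟨ℓ u, Algebra.subset_adjoin ⟨u, hu, rfl⟩, rfl⟩
    | algebraMap r =>
      obtain ⟨r, rfl⟩ := Ideal.Quotient.mk_surjective r
      exact ⟨algebraMap R _ r, Subalgebra.algebraMap_mem _ r, (π Q).commutes r⟩
    | add c d _ _ hc hd =>
      obtain ⟨a, ha, rfl⟩ := hc
      obtain ⟨a', ha', rfl⟩ := hd
      exact ⟨a + a', add_mem ha ha', map_add _ _ _⟩
    | mul c d _ _ hc hd =>
      obtain ⟨a, ha, rfl⟩ := hc
      obtain ⟨a', ha', rfl⟩ := hd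
      exact ⟨a * a', mul_mem ha ha', map_mul _ _ _⟩
  · rw [← IsNilpotent.map_iff e.injective, MvPolynomial.isNilpotent_iff]
    intro m
    rw [← mem_nilradical, nilradical, ← Ideal.sInf_minimalPrimes, Submodule.mem_sInf]
    intro Q hQ
    have h0 : MvPolynomial.map (Ideal.Quotient.mk Q) (e z) = 0 := hz ⟨Q, hQ⟩
    rw [← Ideal.Quotient.eq_zero_iff_mem, ← MvPolynomial.coeff_map, h0, MvPolynomial.coeff_zero]

end MinimalPrimes

theorem theorem2p2 {R : Type u} [CommRing R] [IsNoetherianRing R]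
    {M : Type v} [AddCommGroup M] [Module R M] [Module.Finite R M]
    (U L : Submodule R M) (hUL : U ≤ L)
    {F : Type w} [AddCommGroup F] [Module R F] (f : M →ₗ[R] F) (hf : IsVersal f) :
    List.TFAE [
      IsIntegralIn U L,
      ∀ Q ∈ minimalPrimes R,
        IsIntegralWithin (imageMod Q f U) (imageMod Q f L) (imageMod Q f ⊤),
      ∀ (G : Type (max u g)) [AddCommGroup G] [Module R G] [Module.Free R G] (φ : M →ₗ[R] G)
        (S : Type (max u s)) [CommRing S] [IsDomain S] [Algebra R S],
        IsIntegralWithin (imageTensor S φ U) (imageTensor S φ L) (imageTensor S φ ⊤),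
      ∀ (V : Type (max u s)) [CommRing V] [IsDomain V] [IsDiscreteValuationRing V] [Algebra R V],
        RingHom.ker (algebraMap R V) ∈ minimalPrimes R →
          imageTensor V f U = imageTensor V f L,
      ∀ (G : Type (max u g)) [AddCommGroup G] [Module R G] [Module.Free R G] (φ : M →ₗ[R] G)
        (V : Type (max u s)) [CommRing V] [IsDomain V] [IsDiscreteValuationRing V] [Algebra R V],
        imageTensor V φ U = imageTensor V φ L] := by
  have hfree := hf.1
  tfae_have 1 → 3 := fun h G _ _ _ φ S _ _ _ ↦
    (isIntegralWithin_imageTensor_iff φ U L).mpr ((h.isIntegralVia φ).baseChange S)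
  tfae_have 3 → 5 := fun h G _ _ _ φ V _ _ _ _ ↦
    ((isIntegralWithin_imageTensor_iff φ U L).mp (h G φ V)).imageTensor_eq hUL
  tfae_have 5 → 4 := fun h V _ _ _ _ _ ↦ by
    -- `F` may live in another universe than the modules `G`, so `f` is replaced by a map to `Rⁿ`.
    obtain ⟨n, p, i, hpi⟩ := exists_fin_retraction (R := R) (N := LinearMap.range f)
      (Module.Finite.iff_fg.mp inferInstance)
    let e : ULift.{max u g} (Fin n → R) ≃ₗ[R] (Fin n → R) := ULift.moduleEquiv
    have hfac : f = (i ∘ₗ e.toLinearMap) ∘ₗ (e.symm.toLinearMap ∘ₗ p ∘ₗ f) := by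
      ext x
      simp [hpi (f x) ⟨x, rfl⟩]
    rw [hfac, imageTensor_comp V (i ∘ₗ e.toLinearMap) (e.symm.toLinearMap ∘ₗ p ∘ₗ f) U,
      imageTensor_comp V (i ∘ₗ e.toLinearMap) (e.symm.toLinearMap ∘ₗ p ∘ₗ f) L,
      h (ULift.{max u g} (Fin n → R))]
  tfae_have 4 → 2 := fun h Q hQ ↦ by
    have : Q.IsPrime := hQ.1.1
    exact (isIntegralWithin_imageMod_iff Q f U L).mpr
      (isIntegralVia_quotient_of_forall_imageTensor_eq.{u, v, w, s} Q
        fun V _ _ _ _ hV ↦ h V (hV ▸ hQ))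
  tfae_have 2 → 1 := fun h ↦
    (isIntegralIn_iff_isIntegralVia hf.ker_symMap).mpr
      (isIntegralVia_of_forall_minimalPrimes fun Q hQ ↦ by
        have : Q.IsPrime := hQ.1.1
        exact (isIntegralWithin_imageMod_iff Q f U L).mp (h Q hQ))
  tfae_finish
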